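/- Let $k$ be a commutative ring (e.g. $k=\mathbb{C}$, or $k=\mathbb{Z}$ for plain rings). A supermanifold $\mathfrak{X}$ over $k$ consists of a locally ringed space $(X,\mathcal{O}_X)$, a sheaf $\mathcal{O}_\mathfrak{X}=\mathcal{O}_{\mathfrak{X},+}\oplus\mathcal{O}_{\mathfrak{X},-}$ of local supercommutative $k$-superalgebras on $X$ and an epimorphism (the augmentation) $\mathcal{O}_\mathfrak{X}\to\mathcal{O}_X$ of sheaves of rings, such that for some locally free $\mathcal{O}_X$-module $\mathcal{E}$ of finite constant rank the augmented sheaves of superalgebras $\mathcal{O}_\mathfrak{X}$ and $\wedge^\bullet_{\mathcal{O}_X}\mathcal{E}$ are locally isomorphic. Write $\dim_-\mathfrak{X}=\operatorname{rank}\mathcal{E}$ and let $\mathcal{J}_\mathfrak{X}=\ker(\mathcal{O}_\mathfrak{X}\to\mathcal{O}_X)$ be the fermionic ideal, with $\mathcal{J}_\mathfrak{X}^0=\mathcal{O}_\mathfrak{X}$. Let $(\mathcal{A}ut\,\mathcal{O}_\mathfrak{X})_+$ be the sheaf of groups whose sections over an open set $U$ are the parity-preserving automorphisms of the sheaf of $k$-algebras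 $\mathcal{O}_\mathfrak{X}|_U$, and for $m\geq 0$ put $$\mathcal{G}^{(m)}_{\mathcal{O}_\mathfrak{X}}=\{\alpha\in(\mathcal{A}ut\,\mathcal{O}_\mathfrak{X})_+ \mid \alpha(u)-u\in\mathcal{J}_\mathfrak{X}^m\text{ for all sections }u\};$$ for $m<0$, where $\mathcal{J}_\mathfrak{X}^m$ is not defined, $\mathcal{G}^{(m)}_{\mathcal{O}_\mathfrak{X}}$ has by convention no sections. **Theorem.** For any supermanifold $\mathfrak{X}$, the automorphism sheaves $(\mathcal{G}^{(m)}_{\mathcal{O}_\mathfrak{X}})_{m\in\mathbb{Z}}$ satisfy: (i) for all $m>\dim_-\mathfrak{X}$, $\mathcal{G}^{(m)}_{\mathcal{O}_\mathfrak{X}}=\{\mathbf{1}\}$; (ii) for all $m<0$, $\mathcal{G}^{(m)}_{\mathcal{O}_\mathfrak{X}}=\emptyset$; (iii) for all $m\geq 0$, $\mathcal{G}^{(m+1)}_{\mathcal{O}_\mathfrak{X}}\subset\mathcal{G}^{(m)}_{\mathcal{O}_\mathfrak{X}}$ is a normal subsheaf of groups; (iv) for all $m\geq 2$, the quotient sheaf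 of groups $\mathcal{G}^{(m)}_{\mathcal{O}_\mathfrak{X}}/\mathcal{G}^{(m+1)}_{\mathcal{O}_\mathfrak{X}}$ is abelian. -/

import Mathlib

open CategoryTheory Opposite TopologicalSpace AlgebraicGeometry

universe v u

/-- A *superspace* over a commutative base ring `k` (for complex supergeometry `k = ℂ`; for plain
rings `k = ℤ`): a locally ringed space `(X, 𝒪_X)`, a sheaf `𝒪` of local supercommutative
`k`-superalgebras on `X`, and an epimorphism of sheaves of rings `𝒪 ⟶ 𝒪_X`, the augmentation. -/
structure Superspace (k : Type v) [CommRing k] where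
  /-- The reduced space `(X, 𝒪_X)`. -/
  reduced : LocallyRingedSpace.{u}
  /-- The structure sheaf `𝒪`. -/
  sheaf : TopCat.Sheaf (AlgCat.{u} k) reduced.toTopCat
  /-- The stalks of `𝒪` are local rings. -/
  isLocalRing_stalk : ∀ x : reduced.toTopCat,
    IsLocalRing (TopCat.Presheaf.stalk (C := RingCat.{u})
      (sheaf.obj ⋙ forget₂ (AlgCat.{u} k) RingCat.{u}) x)
  /-- `parity U 0` and `parity U 1` are the even and the odd sections over `U`. -/
  parity : ∀ U : Opens reduced.toTopCat, ZMod 2 → Submodule k (sheaf.obj.obj (op U))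
  gradedMonoid : ∀ U, SetLike.GradedMonoid (parity U)
  isInternal : ∀ U, DirectSum.IsInternal (parity U)
  /-- Restriction maps preserve parity. -/
  map_mem_parity : ∀ {U V : Opens reduced.toTopCat} (f : op U ⟶ op V) (i : ZMod 2)
    (s : sheaf.obj.obj (op U)), s ∈ parity U i → (sheaf.obj.map f).hom s ∈ parity V i
  /-- Supercommutativity. -/
  supercommutative : ∀ (U : Opens reduced.toTopCat) (i j : ZMod 2)
    (a b : sheaf.obj.obj (op U)), a ∈ parity U i → b ∈ parity U j →
      a * b = (-1) ^ (i.val * j.val) * (b * a)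
  /-- The augmentation `𝒪 ⟶ 𝒪_X`. -/
  augmentation : (sheaf.obj ⋙ forget₂ (AlgCat.{u} k) RingCat.{u}) ⟶
    (reduced.presheaf ⋙ forget₂ CommRingCat.{u} RingCat.{u})
  /-- The augmentation is an epimorphism of sheaves, i.e. it is locally surjective. -/
  augmentation_epi : TopCat.Presheaf.IsLocallySurjective augmentation

/-- Filtered colimits of groups exist. -/
instance GrpCat.hasColimitsOfShape_of_isFiltered (J : Type u) [SmallCategory J] [IsFiltered J] :
    Limits.HasColimitsOfShape J GrpCat.{u} where
  has_colimit F := ⟨⟨⟨_, GrpCat.FilteredColimits.colimitCoconeIsColimit.{u, u} F⟩⟩⟩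

namespace Superspace

section Base

/-- The ring of sections `𝒪_X(U)` of a locally ringed space. -/
abbrev OX (X : LocallyRingedSpace.{u}) (U : Opens X.toTopCat) : Type u :=
  X.presheaf.obj (op U)

/-- The restriction map `𝒪_X(U) → 𝒪_X(V)`. -/
abbrev resX (X : LocallyRingedSpace.{u}) {U V : Opens X.toTopCat} (h : V ≤ U) :
    OX X U →+* OX X V :=
  (X.presheaf.map (homOfLE h).op).hom

/-- The structure sheaf of a locally ringed space as a sheaf of (not necessarily commutative)
rings, as required by `SheafOfModules`. -/
noncomputable abbrev ringSheaf (X : LocallyRingedSpace.{u}) : TopCat.Sheaf RingCat.{u} X.toTopCat :=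
  (sheafCompose _ (forget₂ CommRingCat.{u} RingCat.{u})).obj X.sheaf

variable {X : LocallyRingedSpace.{u}} (E : SheafOfModules.{u} (ringSheaf X))

/-- The sections `E(U)` of a sheaf of `𝒪_X`-modules. -/
def Sec (U : Opens X.toTopCat) : Type u := E.val.obj (op U)

noncomputable instance (U : Opens X.toTopCat) : AddCommGroup (Sec E U) :=
  inferInstanceAs (AddCommGroup (E.val.obj (op U)))

noncomputable instance (U : Opens X.toTopCat) : Module (OX X U) (Sec E U) :=
  inferInstanceAs (Module ((ringSheaf X).obj.obj (op U)) (E.val.obj (op U)))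

/-- The restriction map `E(U) → E(V)`, semilinear over `𝒪_X(U) → 𝒪_X(V)`. -/
noncomputable def Sec.res {U V : Opens X.toTopCat} (h : V ≤ U) :
    Sec E U →ₛₗ[resX X h] Sec E V where
  toFun e := (E.val.map (homOfLE h).op).hom e
  map_add' a b := map_add (E.val.map (homOfLE h).op).hom a b
  map_smul' r a := E.val.map_smul (homOfLE h).op r a

/-- `E` is free of rank `q` on the open set `U`: there are sections `e₁, …, e_q` over `U` whose
restrictions to every open `V ⊆ U` form a basis of the `𝒪_X(V)`-module `E(V)`. -/
def IsFreeOn (q : ℕ) (U : Opens X.toTopCat) : Prop :=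
  ∃ e : Fin q → Sec E U, ∀ (V : Opens X.toTopCat) (h : V ≤ U),
    ∃ b : Module.Basis (Fin q) (OX X V) (Sec E V), ∀ i, b i = Sec.res E h (e i)

/-- `E` is a locally free sheaf of rank `q`. -/
def IsLocallyFreeOfRank (q : ℕ) : Prop :=
  ∀ x : X.toTopCat, ∃ U : Opens X.toTopCat, x ∈ U ∧ IsFreeOn E q U

/-- The exterior algebra `⋀_{𝒪_X(U)} E(U)`. -/
abbrev Ext (U : Opens X.toTopCat) : Type u := ExteriorAlgebra (OX X U) (Sec E U)

/-- The restriction map `⋀_{𝒪_X(U)} E(U) → ⋀_{𝒪_X(V)} E(V)`: the unique ring homomorphism that is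
the restriction map on `𝒪_X(U)` and on `E(U)`. -/
noncomputable def Ext.res {U V : Opens X.toTopCat} (h : V ≤ U) : Ext E U →+* Ext E V :=
  letI : Algebra (OX X U) (Ext E V) := Algebra.compHom (Ext E V) (resX X h)
  (ExteriorAlgebra.lift (OX X U) (A := Ext E V)
    ⟨{ toFun := fun e => ExteriorAlgebra.ι (OX X V) (Sec.res E h e)
       map_add' := fun a b => by rw [map_add, map_add]
       map_smul' := fun r a => by rw [map_smulₛₗ, map_smul]; rfl },
      fun _ => ExteriorAlgebra.ι_sq_zero _⟩).toRingHom

end Base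

variable {k : Type v} [CommRing k] (𝔛 : Superspace.{v, u} k)

/-- The open subsets of the underlying topological space. -/
abbrev Op : Type u := Opens 𝔛.reduced.toTopCat

/-- The superalgebra of sections `𝒪(U)`. -/
abbrev O (U : 𝔛.Op) : Type u := 𝔛.sheaf.obj.obj (op U)

/-- The restriction map `𝒪(U) → 𝒪(V)`. -/
abbrev res {U V : 𝔛.Op} (h : V ≤ U) : 𝔛.O U →ₐ[k] 𝔛.O V :=
  (𝔛.sheaf.obj.map (homOfLE h).op).hom

/-- The augmentation `𝒪(U) → 𝒪_X(U)` on sections. -/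
def body (U : 𝔛.Op) : 𝔛.O U →+* OX 𝔛.reduced U :=
  (𝔛.augmentation.app (op U)).hom

/-- `𝔛` is isomorphic over `U` to `⋀_{𝒪_X} E`, where `E` is free on `U`: there are ring isomorphisms
`𝒪(V) ≃ ⋀_{𝒪_X(V)} E(V)` for all open `V ⊆ U`, compatible with restrictions, with parities, with the
augmentations and with the action of `k` (which acts on `𝒪_X` through the augmentation).
As `E` is free of finite rank on `U`, the presheaf `V ↦ ⋀_{𝒪_X(V)} E(V)` on `U` is the sheaf
`⋀_{𝒪_X} E` there. -/
def IsoToExteriorOn (E : SheafOfModules.{u} (ringSheaf 𝔛.reduced)) (U : 𝔛.Op) : Prop :=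
  ∃ φ : ∀ V : 𝔛.Op, V ≤ U → (𝔛.O V ≃+* Ext E V),
    (∀ (V W : 𝔛.Op) (hV : V ≤ U) (hW : W ≤ V) (s : 𝔛.O V),
      φ W (hW.trans hV) (𝔛.res hW s) = Ext.res E hW (φ V hV s)) ∧
    (∀ (V : 𝔛.Op) (hV : V ≤ U) (i : ZMod 2) (s : 𝔛.O V),
      s ∈ 𝔛.parity V i ↔
        φ V hV s ∈ CliffordAlgebra.evenOdd (0 : QuadraticForm (OX 𝔛.reduced V) (Sec E V)) i) ∧
    (∀ (V : 𝔛.Op) (hV : V ≤ U) (s : 𝔛.O V),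
      ExteriorAlgebra.algebraMapInv (φ V hV s) = 𝔛.body V s) ∧
    (∀ (V : 𝔛.Op) (hV : V ≤ U) (c : k),
      φ V hV (algebraMap k (𝔛.O V) c) =
        algebraMap (OX 𝔛.reduced V) (Ext E V) (𝔛.body V (algebraMap k (𝔛.O V) c)))

/-- `𝔛` is modelled on `(X, E)`, with `E` locally free of rank `q`: the sheaves `𝒪` and
`⋀_{𝒪_X} E` are locally isomorphic. -/
def IsModelledOn (E : SheafOfModules.{u} (ringSheaf 𝔛.reduced)) (q : ℕ) : Prop :=
  IsLocallyFreeOfRank E q ∧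
    ∀ x : 𝔛.reduced.toTopCat, ∃ U : 𝔛.Op, x ∈ U ∧ IsFreeOn E q U ∧ 𝔛.IsoToExteriorOn E U

section Fermionic

/-- The fermionic ideal on sections: the kernel of `𝒪(U) → 𝒪_X(U)`. -/
def fermionicIdeal (U : 𝔛.Op) : Ideal (𝔛.O U) := RingHom.ker (𝔛.body U)

instance (U : 𝔛.Op) : (𝔛.fermionicIdeal U).IsTwoSided :=
  inferInstanceAs (RingHom.ker (𝔛.body U)).IsTwoSided

theorem body_res {U V : 𝔛.Op} (h : V ≤ U) (s : 𝔛.O U) :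
    𝔛.body V (𝔛.res h s) = resX 𝔛.reduced h (𝔛.body U s) :=
  ConcreteCategory.congr_hom (𝔛.augmentation.naturality (homOfLE h).op) s

theorem res_mem_fermionicIdeal_pow {U V : 𝔛.Op} (h : V ≤ U) (m : ℕ) {s : 𝔛.O U}
    (hs : s ∈ 𝔛.fermionicIdeal U ^ m) : 𝔛.res h s ∈ 𝔛.fermionicIdeal V ^ m := by
  induction m generalizing s with
  | zero => rw [Submodule.pow_zero, Ideal.one_eq_top]; trivial
  | succ n ih =>
    rw [Submodule.pow_succ] at hs ⊢
    refine Submodule.mul_induction_on hs (fun a ha b hb => ?_) (fun a b ha hb => ?_)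
    · rw [map_mul]
      refine Ideal.mul_mem_mul (ih ha) ?_
      rw [fermionicIdeal, RingHom.mem_ker] at hb ⊢
      rw [body_res, hb, map_zero]
    · rw [map_add]; exact add_mem ha hb

theorem res_res {U V W : 𝔛.Op} (h : V ≤ U) (h' : W ≤ V) (s : 𝔛.O U) :
    𝔛.res h' (𝔛.res h s) = 𝔛.res (h'.trans h) s := by
  have := 𝔛.sheaf.obj.map_comp (homOfLE h).op (homOfLE h').op
  exact (ConcreteCategory.congr_hom this s).symm

/-- The sections over `U` of the sheaf of ideals `𝒥^m`: those sections of `𝒪` that locally lie in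
the `m`-th power of the fermionic ideal; `𝒥^0 = 𝒪`. -/
def fermionicPow (m : ℕ) (U : 𝔛.Op) : Ideal (𝔛.O U) where
  carrier := {s | ∀ x ∈ U, ∃ (V : 𝔛.Op) (h : V ≤ U), x ∈ V ∧ 𝔛.res h s ∈ 𝔛.fermionicIdeal V ^ m}
  zero_mem' := fun x hx => ⟨U, le_rfl, hx, by rw [map_zero]; exact zero_mem _⟩
  add_mem' := fun {a b} ha hb x hx => by
    obtain ⟨V, h, hxV, hV⟩ := ha x hx
    obtain ⟨W, h', hxW, hW⟩ := hb x hx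
    refine ⟨V ⊓ W, inf_le_left.trans h, ⟨hxV, hxW⟩, ?_⟩
    rw [map_add]
    refine add_mem ?_ ?_
    · rw [← 𝔛.res_res h inf_le_left]
      exact 𝔛.res_mem_fermionicIdeal_pow _ _ hV
    · have := 𝔛.res_mem_fermionicIdeal_pow (inf_le_right : V ⊓ W ≤ W) _ hW
      rwa [𝔛.res_res] at this
  smul_mem' := fun c s hs x hx => by
    obtain ⟨V, h, hxV, hV⟩ := hs x hx
    refine ⟨V, h, hxV, ?_⟩
    rw [smul_eq_mul, map_mul]
    exact Ideal.mul_mem_left _ _ hV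

end Fermionic

/-- A section over `U` of the sheaf `(𝒜ut 𝒪)_+` of even automorphisms: an automorphism of the sheaf
of `k`-superalgebras `𝒪|_U`. -/
@[ext]
structure EvenAut (U : 𝔛.Op) where
  /-- The automorphism on the sections over `V ⊆ U`. -/
  app : ∀ V : 𝔛.Op, V ≤ U → (𝔛.O V ≃ₐ[k] 𝔛.O V)
  naturality : ∀ (V W : 𝔛.Op) (hV : V ≤ U) (hW : W ≤ V) (s : 𝔛.O V),
    app W (hW.trans hV) (𝔛.res hW s) = 𝔛.res hW (app V hV s)
  app_mem_parity : ∀ (V : 𝔛.Op) (hV : V ≤ U) (i : ZMod 2) (s : 𝔛.O V),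
    app V hV s ∈ 𝔛.parity V i ↔ s ∈ 𝔛.parity V i

namespace EvenAut

variable {𝔛} {U : 𝔛.Op}

instance : One (𝔛.EvenAut U) where
  one := ⟨fun _ _ => 1, fun _ _ _ _ _ => rfl, fun _ _ _ _ => Iff.rfl⟩

/-- Multiplication is composition of automorphisms. -/
instance : Mul (𝔛.EvenAut U) where
  mul a b := ⟨fun V hV => a.app V hV * b.app V hV,
    fun V W hV hW s => by
      rw [AlgEquiv.mul_apply, AlgEquiv.mul_apply, b.naturality, a.naturality],
    fun V hV i s => by rw [AlgEquiv.mul_apply, a.app_mem_parity, b.app_mem_parity]⟩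

instance : Inv (𝔛.EvenAut U) where
  inv a := ⟨fun V hV => (a.app V hV)⁻¹,
    fun V W hV hW s => by
      apply (a.app W (hW.trans hV)).injective
      rw [a.naturality V W hV hW]
      exact ((a.app W _).apply_symm_apply _).trans
        (congrArg (𝔛.res hW) ((a.app V hV).apply_symm_apply s).symm),
    fun V hV i s => by
      rw [← a.app_mem_parity V hV]
      exact iff_of_eq (congrArg (· ∈ 𝔛.parity V i) ((a.app V hV).apply_symm_apply s))⟩

theorem one_app (V : 𝔛.Op) (hV : V ≤ U) : (1 : 𝔛.EvenAut U).app V hV = 1 := rfl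

theorem mul_app (a b : 𝔛.EvenAut U) (V : 𝔛.Op) (hV : V ≤ U) :
    (a * b).app V hV = a.app V hV * b.app V hV := rfl

theorem inv_app (a : 𝔛.EvenAut U) (V : 𝔛.Op) (hV : V ≤ U) :
    a⁻¹.app V hV = (a.app V hV)⁻¹ := rfl

instance : Group (𝔛.EvenAut U) where
  mul_assoc _ _ _ := rfl
  one_mul _ := rfl
  mul_one _ := rfl
  inv_mul_cancel a := by
    ext V hV s
    rw [mul_app, inv_app, one_app, inv_mul_cancel]

/-- Restriction of automorphisms to a smaller open set. -/
def restrict {V : 𝔛.Op} (h : V ≤ U) : 𝔛.EvenAut U →* 𝔛.EvenAut V where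
  toFun a := ⟨fun W hW => a.app W (hW.trans h), fun W W' _ hW' s => a.naturality W W' _ hW' s,
    fun W _ i s => a.app_mem_parity W _ i s⟩
  map_one' := rfl
  map_mul' _ _ := rfl

end EvenAut

/-- The sections over `U` of `𝒢^{(m)}`, `m ≥ 0`: the even automorphisms `α` of `𝒪|_U` with
`α(u) - u ∈ 𝒥^m` for all sections `u` of `𝒪|_U`. -/
def autSubgroup (m : ℕ) (U : 𝔛.Op) : Subgroup (𝔛.EvenAut U) where
  carrier := {α | ∀ (V : 𝔛.Op) (hV : V ≤ U) (u : 𝔛.O V), α.app V hV u - u ∈ 𝔛.fermionicPow m V}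
  one_mem' V hV u := by
    rw [EvenAut.one_app, AlgEquiv.one_apply, sub_self]; exact zero_mem _
  mul_mem' {a b} ha hb V hV u := by
    rw [EvenAut.mul_app, AlgEquiv.mul_apply, ← sub_add_sub_cancel _ (b.app V hV u)]
    exact add_mem (ha V hV _) (hb V hV u)
  inv_mem' {a} ha V hV u := by
    have h := ha V hV (a⁻¹.app V hV u)
    have e : a.app V hV (a⁻¹.app V hV u) = u := (a.app V hV).apply_symm_apply u
    rw [e] at h
    rw [← neg_sub]
    exact neg_mem h

/-- The family `𝒢^{(m)}`, indexed by all integers `m`, on sections over `U`: as `𝒥^m` is only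
defined for `m ≥ 0`, there is no section of `𝒢^{(m)}` for negative `m`. -/
def autSections (m : ℤ) (U : 𝔛.Op) : Set (𝔛.EvenAut U) :=
  {α | ∃ n : ℕ, (n : ℤ) = m ∧ α ∈ 𝔛.autSubgroup n U}

theorem restrict_mem_autSubgroup {m : ℕ} {U V : 𝔛.Op} (h : V ≤ U) {α : 𝔛.EvenAut U}
    (hα : α ∈ 𝔛.autSubgroup m U) : EvenAut.restrict h α ∈ 𝔛.autSubgroup m V :=
  fun W hW u => hα W (hW.trans h) u

/-- `𝒢^{(m+1)}` is a normal subsheaf of groups of `𝒢^{(m)}`. -/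
def IsNormalInclusion (m : ℕ) : Prop :=
  ∀ U : 𝔛.Op, 𝔛.autSubgroup (m + 1) U ≤ 𝔛.autSubgroup m U ∧
    ((𝔛.autSubgroup (m + 1) U).subgroupOf (𝔛.autSubgroup m U)).Normal

/-- The restriction map `𝒢^{(m)}(U) → 𝒢^{(m)}(V)`. -/
def autRestrict (m : ℕ) {U V : 𝔛.Op} (h : V ≤ U) : 𝔛.autSubgroup m U →* 𝔛.autSubgroup m V :=
  ((EvenAut.restrict h).comp (𝔛.autSubgroup m U).subtype).codRestrict _
    fun α => 𝔛.restrict_mem_autSubgroup h α.2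

theorem autRestrict_le_comap (m : ℕ) {U V : 𝔛.Op} (h : V ≤ U) :
    (𝔛.autSubgroup (m + 1) U).subgroupOf (𝔛.autSubgroup m U) ≤
      ((𝔛.autSubgroup (m + 1) V).subgroupOf (𝔛.autSubgroup m V)).comap (𝔛.autRestrict m h) :=
  fun _ hα => 𝔛.restrict_mem_autSubgroup h hα

/-- The presheaf of groups `U ↦ 𝒢^{(m)}(U) / 𝒢^{(m+1)}(U)`. -/
def quotientPresheaf (m : ℕ) (hN : 𝔛.IsNormalInclusion m) :
    TopCat.Presheaf GrpCat.{u} 𝔛.reduced.toTopCat :=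
  haveI := fun U => (hN U).2
  { obj := fun U => GrpCat.of (𝔛.autSubgroup m U.unop ⧸
      (𝔛.autSubgroup (m + 1) U.unop).subgroupOf (𝔛.autSubgroup m U.unop))
    map := fun f => GrpCat.ofHom
      (QuotientGroup.map _ _ (𝔛.autRestrict m f.unop.le) (𝔛.autRestrict_le_comap m f.unop.le))
    map_id := fun U => by
      refine GrpCat.hom_ext (MonoidHom.ext fun x => ?_)
      induction x using QuotientGroup.induction_on
      rfl
    map_comp := fun f g => by
      refine GrpCat.hom_ext (MonoidHom.ext fun x => ?_)
      induction x using QuotientGroup.induction_on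
      rfl }

/-- The quotient sheaf of groups `𝒢^{(m)} / 𝒢^{(m+1)}`. -/
noncomputable def quotientSheaf (m : ℕ) (hN : 𝔛.IsNormalInclusion m) :
    TopCat.Sheaf GrpCat.{u} 𝔛.reduced.toTopCat :=
  (presheafToSheaf (Opens.grothendieckTopology 𝔛.reduced.toTopCat) GrpCat.{u}).obj
    (𝔛.quotientPresheaf m hN)

end Superspace

/-- A *supermanifold*: a superspace whose structure sheaf is locally isomorphic to the exterior
algebra of a locally free sheaf `E` of `𝒪_X`-modules. -/
structure Supermanifold (k : Type v) [CommRing k] extends Superspace.{v, u} k where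
  /-- The odd dimension: the rank of the locally free sheaf `E`. -/
  oddDim : ℕ
  exists_model : ∃ E : SheafOfModules.{u} (Superspace.ringSheaf reduced),
    toSuperspace.IsModelledOn E oddDim

/-! Write J for the fermionic ideal. Locally `𝒪` is an exterior algebra on q generators and J is the
kernel of its augmentation. Two facts about this model suffice. First, Jⁿ = 0 for n > q, so an
automorphism congruent to the identity modulo Jⁿ is the identity. Second, J is generated by the odd
elements; it is thus determined by the parity, and every even automorphism preserves all powers of
J. Conjugation therefore preserves each `𝒢^(m)`, which gives normality.

For commutativity, let α - 1 and β - 1 map `𝒪` into J^m. The twisted Leibniz rule α(ab) - ab = (α(a)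
- a)α(b) + a(α(b) - b) shows that α - 1 maps J^(n+1) into J^(m+n) (`app_sub_mem_fermionicPow`).
Hence βα - αβ = (β - 1)(α - 1) - (α - 1)(β - 1) maps `𝒪` into J^(2m-1), which lies in J^(m+1)
exactly when exponents satisfy m ≥ 2. The quotient presheaf is then abelian, and so is its
sheafification. -/

namespace ExteriorAlgebra

/-! ### The augmentation ideal of an exterior algebra -/

variable {R M : Type*} [CommRing R] [AddCommGroup M] [Module R M]

theorem algebraMapInv_eq_zero_of_odd {x : ExteriorAlgebra R M}
    (hx : x ∈ CliffordAlgebra.evenOdd (0 : QuadraticForm R M) 1) : algebraMapInv x = 0 := by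
  have hι (v : M) : algebraMapInv (CliffordAlgebra.ι (0 : QuadraticForm R M) v) = 0 := by
    simp [algebraMapInv]
  induction x, hx using CliffordAlgebra.odd_induction with
  | ι v => exact hι v
  | add x y hx hy ihx ihy => rw [map_add, ihx, ihy, add_zero]
  | ι_mul_ι_mul a b x hx ih => rw [map_mul, ih, mul_zero]

theorem mem_span_odd_of_algebraMapInv_eq_zero {x : ExteriorAlgebra R M}
    (hx : algebraMapInv x = 0) :
    x ∈ Ideal.span (CliffordAlgebra.evenOdd (0 : QuadraticForm R M) 1 :
      Set (ExteriorAlgebra R M)) := by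
  -- The vanishing hypothesis does not pass to the factors of a product, so the induction runs on x
  -- minus its scalar part.
  suffices h : x - algebraMap R _ (algebraMapInv x) ∈
      Ideal.span (CliffordAlgebra.evenOdd (0 : QuadraticForm R M) 1 :
        Set (ExteriorAlgebra R M)) by
    simpa [hx] using h
  clear hx
  induction x using ExteriorAlgebra.induction with
  | algebraMap r => simp [algebraMapInv]
  | ι v =>
    have : algebraMapInv (ι R v) = 0 := by simp [algebraMapInv]
    rw [this, map_zero, sub_zero]
    exact Ideal.subset_span (CliffordAlgebra.ι_mem_evenOdd_one _ _)
  | mul a b iha ihb =>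
    have : a * b - algebraMap R _ (algebraMapInv (a * b)) =
        a * (b - algebraMap R _ (algebraMapInv b)) +
          algebraMap R _ (algebraMapInv b) * (a - algebraMap R _ (algebraMapInv a)) := by
      rw [map_mul, map_mul, mul_sub, mul_sub, Algebra.commutes (algebraMapInv b) a,
        ← map_mul (algebraMap R (ExteriorAlgebra R M)) (algebraMapInv b), mul_comm (algebraMapInv b),
        map_mul]
      abel
    rw [this]
    exact add_mem (Ideal.mul_mem_left _ _ ihb) (Ideal.mul_mem_left _ _ iha)
  | add a b iha ihb =>
    rw [map_add, map_add, add_sub_add_comm]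
    exact add_mem iha ihb

/-- Vectors anticommute, so a vector on the right can be moved to the left past any element. This
collects the vectors of a product of augmentation-ideal elements in front. -/
theorem top_mul_range_ι_le : (⊤ : Submodule R (ExteriorAlgebra R M)) * LinearMap.range (ι R) ≤
    LinearMap.range (ι R) * ⊤ := by
  rw [Submodule.mul_le]
  rintro a - _ ⟨v, rfl⟩
  induction a using ExteriorAlgebra.induction generalizing v with
  | algebraMap r =>
    rw [Algebra.commutes]
    exact Submodule.mul_mem_mul ⟨v, rfl⟩ trivial
  | ι w =>
    rw [eq_neg_of_add_eq_zero_left (ι_add_mul_swap w v)]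
    exact neg_mem (Submodule.mul_mem_mul ⟨v, rfl⟩ trivial)
  | mul a b iha ihb =>
    rw [mul_assoc]
    refine Submodule.mul_induction_on (ihb v) ?_ fun x y hx hy => ?_
    · rintro _ ⟨w, rfl⟩ c -
      rw [← mul_assoc]
      have := Submodule.mul_mem_mul (iha w) (Submodule.mem_top (x := c))
      rw [mul_assoc] at this
      exact SetLike.le_def.mp (mul_le_mul' le_rfl le_top) this
    · rw [mul_add]
      exact add_mem hx hy
  | add a b iha ihb => rw [add_mul]; exact add_mem (iha v) (ihb v)

theorem mem_range_ι_mul_top_of_algebraMapInv_eq_zero {x : ExteriorAlgebra R M}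
    (hx : algebraMapInv x = 0) : x ∈ LinearMap.range (ι R (M := M)) * ⊤ := by
  refine Submodule.span_induction (fun y hy => ?_) (zero_mem _) (fun _ _ _ _ => add_mem)
    (fun a y _ hy => ?_) (mem_span_odd_of_algebraMapInv_eq_zero hx)
  · induction y, hy using CliffordAlgebra.odd_induction with
    | ι v =>
      have := Submodule.mul_mem_mul (LinearMap.mem_range_self (ι R) v)
        (Submodule.mem_top (x := (1 : ExteriorAlgebra R M)))
      rwa [mul_one] at this
    | add x y _ _ ihx ihy => exact add_mem ihx ihy
    | ι_mul_ι_mul a b x _ _ =>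
      rw [mul_assoc]
      exact Submodule.mul_mem_mul (LinearMap.mem_range_self (ι R) a) trivial
  · have := Submodule.mul_mem_mul (Submodule.mem_top (x := a)) hy
    rw [← mul_assoc] at this
    have := SetLike.le_def.mp (mul_le_mul' top_mul_range_ι_le le_rfl) this
    rw [mul_assoc] at this
    exact SetLike.le_def.mp (mul_le_mul' le_rfl le_top) this

theorem mem_range_ι_pow_mul_top_of_mem_ker_pow {n : ℕ} {x : ExteriorAlgebra R M}
    (hx : x ∈ RingHom.ker (algebraMapInv (R := R) (M := M)) ^ n) :
    x ∈ LinearMap.range (ι R (M := M)) ^ n * ⊤ := by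
  induction n generalizing x with
  | zero =>
    rw [pow_zero, one_mul]; trivial
  | succ n ih =>
    rw [Submodule.pow_succ] at hx
    refine Submodule.mul_induction_on hx (fun a ha b hb => ?_) (fun _ _ => add_mem)
    have := Submodule.mul_mem_mul (ih ha) (mem_range_ι_mul_top_of_algebraMapInv_eq_zero hb)
    rw [mul_assoc, ← mul_assoc ⊤] at this
    have := SetLike.le_def.mp (mul_le_mul' le_rfl (mul_le_mul' top_mul_range_ι_le le_rfl)) this
    rw [mul_assoc, ← mul_assoc, ← pow_succ] at this
    exact SetLike.le_def.mp (mul_le_mul' le_rfl le_top) this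

/-- The n-th power is spanned by the values of the alternating map `ιMulti`, which is determined by
its values on n distinct basis vectors; there are only q < n of them. -/
theorem range_ι_pow_eq_bot {q n : ℕ} (b : Module.Basis (Fin q) R M) (h : q < n) :
    LinearMap.range (ι R (M := M)) ^ n = ⊥ := by
  have h0 : ιMulti R n (M := M) = 0 := by
    refine b.ext_alternating fun v hv => ?_
    have := Fintype.card_le_of_injective v hv
    simp only [Fintype.card_fin] at this
    omega
  have := ιMulti_span_fixedDegree (R := R) (M := M) n
  rw [h0] at this
  refine this.symm.trans ?_
  rw [Submodule.span_eq_bot]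
  rintro _ ⟨v, rfl⟩
  rfl

theorem eq_zero_of_mem_ker_pow {q n : ℕ} (b : Module.Basis (Fin q) R M) (h : q < n)
    {x : ExteriorAlgebra R M} (hx : x ∈ RingHom.ker (algebraMapInv (R := R) (M := M)) ^ n) :
    x = 0 := by
  have := mem_range_ι_pow_mul_top_of_mem_ker_pow hx
  rwa [range_ι_pow_eq_bot b h, Submodule.bot_mul, Submodule.mem_bot] at this

end ExteriorAlgebra

/-! ### Commutativity under sheafification, and powers of ideals under ring maps -/

/-- The sheafification of a presheaf of abelian groups is a sheaf of abelian groups. -/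
theorem TopCat.Presheaf.mul_comm_sheafify {X : TopCat.{u}} (P : TopCat.Presheaf GrpCat.{u} X)
    (hP : ∀ (U : Opens X) (a b : P.obj (op U)), a * b = b * a) (U : Opens X)
    (a b : ((presheafToSheaf (Opens.grothendieckTopology X) GrpCat.{u}).obj P).obj.obj (op U)) :
    a * b = b * a := by
  let J := Opens.grothendieckTopology X
  let F : TopCat.Sheaf GrpCat.{u} X := (presheafToSheaf J GrpCat.{u}).obj P
  let η : P ⟶ F.obj := CategoryTheory.toSheafify J P
  have hη : CategoryTheory.Presheaf.IsLocallySurjective J η :=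
    inferInstanceAs (CategoryTheory.Presheaf.IsLocallySurjective J (CategoryTheory.toSheafify J P))
  have key (x : X) (hx : x ∈ U) : ∃ (V : Opens X) (i : V ⟶ U), x ∈ V ∧
      F.obj.map i.op (a * b) = F.obj.map i.op (b * a) := by
    -- Near x both sections come from the presheaf, where they commute; equality in a sheaf is
    -- local.
    obtain ⟨V, i, ⟨a', ha⟩, hxV⟩ := hη.imageSieve_mem (U := U) a x hx
    obtain ⟨W, j, ⟨b', hb⟩, hxW⟩ := hη.imageSieve_mem (U := U) b x hx
    refine ⟨V ⊓ W, homOfLE inf_le_left ≫ i, ⟨hxV, hxW⟩, ?_⟩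
    have ea : F.obj.map (homOfLE (inf_le_left : V ⊓ W ≤ V) ≫ i).op a =
        η.app (op (V ⊓ W)) (P.map (homOfLE inf_le_left).op a') := by
      rw [NatTrans.naturality_apply, ha, op_comp, Functor.map_comp, ConcreteCategory.comp_apply]
    have eb : F.obj.map (homOfLE (inf_le_left : V ⊓ W ≤ V) ≫ i).op b =
        η.app (op (V ⊓ W)) (P.map (homOfLE inf_le_right).op b') := by
      rw [NatTrans.naturality_apply, hb, ← ConcreteCategory.comp_apply, ← Functor.map_comp]
      rfl
    refine (map_mul _ _ _).trans ((?_ : _ = _).trans (map_mul _ _ _).symm)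
    rw [ea, eb]
    exact (map_mul _ _ _).symm.trans ((congrArg _ (hP _ _ _)).trans (map_mul _ _ _))
  choose! V i hxV hV using key
  exact TopCat.Sheaf.eq_of_locally_eq' F (fun x : U => V x) U (fun x => i x x.2)
    (fun x hx => Opens.mem_iSup.mpr ⟨⟨x, hx⟩, hxV x hx⟩) _ _ fun x => hV x x.2

theorem Ideal.map_mem_pow_of_le_comap {A B F : Type*} [Ring A] [Ring B] [FunLike F A B]
    [RingHomClass F A B] (f : F) {I : Ideal A} {J : Ideal B} (h : ∀ x ∈ I, f x ∈ J) {n : ℕ}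
    {x : A} (hx : x ∈ I ^ n) : f x ∈ J ^ n := by
  induction n generalizing x with
  | zero => rw [Submodule.pow_zero, Ideal.one_eq_top]; trivial
  | succ n ih =>
    rw [Submodule.pow_succ] at hx ⊢
    refine Submodule.mul_induction_on hx (fun a ha b hb => ?_) (fun a b ha hb => ?_)
    · rw [map_mul]; exact Ideal.mul_mem_mul (ih ha) (h b hb)
    · rw [map_add]; exact add_mem ha hb

namespace Superspace

variable {k : Type v} [CommRing k] (𝔛 : Superspace.{v, u} k)

theorem eq_of_locally_eq {U : 𝔛.Op} {s t : 𝔛.O U}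
    (h : ∀ x ∈ U, ∃ (V : 𝔛.Op) (h : V ≤ U), x ∈ V ∧ 𝔛.res h s = 𝔛.res h t) : s = t := by
  choose! V hVU hxV hV using h
  exact 𝔛.sheaf.eq_of_locally_eq' (fun x : U => V x) U (fun x => homOfLE (hVU x x.2))
    (fun x hx => Opens.mem_iSup.mpr ⟨⟨x, hx⟩, hxV x hx⟩) _ _ fun x => hV x x.2

/-! ### The fermionic ideal in the local model -/

section Model

variable {𝔛} {E : SheafOfModules.{u} (ringSheaf 𝔛.reduced)} {U V : 𝔛.Op}

/-- This describes the ideal by parity alone, without the augmentation, with which automorphisms are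
not assumed compatible. -/
theorem IsoToExteriorOn.fermionicIdeal_eq_span_odd (hU : 𝔛.IsoToExteriorOn E U) (hV : V ≤ U) :
    𝔛.fermionicIdeal V = Ideal.span (𝔛.parity V 1 : Set (𝔛.O V)) := by
  obtain ⟨φ, -, hpar, hbody, -⟩ := hU
  apply le_antisymm
  · intro s hs
    have h0 : ExteriorAlgebra.algebraMapInv (φ V hV s) = 0 := (hbody V hV s).trans hs
    have h1 := ExteriorAlgebra.mem_span_odd_of_algebraMapInv_eq_zero h0
    rw [← (φ V hV).symm_apply_apply s]
    refine Submodule.span_induction (fun y hy => ?_) ?_ (fun a b _ _ ha hb => ?_)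
      (fun a y _ hy => ?_) h1
    · refine Ideal.subset_span ((hpar V hV 1 _).mpr ?_)
      rwa [RingEquiv.apply_symm_apply]
    · rw [map_zero]; exact zero_mem _
    · rw [map_add]; exact add_mem ha hb
    · rw [smul_eq_mul, map_mul]; exact Ideal.mul_mem_left _ _ hy
  · refine Ideal.span_le.mpr fun s hs => ?_
    exact (hbody V hV s).symm.trans
      (ExteriorAlgebra.algebraMapInv_eq_zero_of_odd ((hpar V hV 1 s).mp hs))

theorem IsoToExteriorOn.eq_zero_of_mem_fermionicIdeal_pow {q n : ℕ} (hU : 𝔛.IsoToExteriorOn E U)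
    (hfree : IsFreeOn E q U) (hV : V ≤ U) (hn : q < n) {s : 𝔛.O V}
    (hs : s ∈ 𝔛.fermionicIdeal V ^ n) : s = 0 := by
  obtain ⟨φ, -, -, hbody, -⟩ := hU
  obtain ⟨e, he⟩ := hfree
  obtain ⟨b, -⟩ := he V hV
  have := ExteriorAlgebra.eq_zero_of_mem_ker_pow b hn
    (Ideal.map_mem_pow_of_le_comap (φ V hV)
      (J := RingHom.ker (ExteriorAlgebra.algebraMapInv (R := OX 𝔛.reduced V) (M := Sec E V)))
      (fun s hs => (hbody V hV s).trans hs) hs)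
  exact (map_eq_zero_iff _ (φ V hV).injective).mp this

end Model

/-- The fermionic ideal is locally generated by the odd sections. -/
def IsGeneratedByOdd : Prop :=
  ∀ x : 𝔛.reduced.toTopCat, ∃ U : 𝔛.Op, x ∈ U ∧ ∀ V ≤ U,
    𝔛.fermionicIdeal V = Ideal.span (𝔛.parity V 1 : Set (𝔛.O V))

theorem IsModelledOn.isGeneratedByOdd {𝔛 : Superspace.{v, u} k}
    {E : SheafOfModules.{u} (ringSheaf 𝔛.reduced)} {q : ℕ} (h : 𝔛.IsModelledOn E q) :
    𝔛.IsGeneratedByOdd := fun x =>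
  let ⟨U, hxU, _, hU⟩ := h.2 x
  ⟨U, hxU, fun _ hV => hU.fermionicIdeal_eq_span_odd hV⟩

theorem IsModelledOn.eq_zero_of_mem_fermionicPow {𝔛 : Superspace.{v, u} k}
    {E : SheafOfModules.{u} (ringSheaf 𝔛.reduced)} {q n : ℕ} (h : 𝔛.IsModelledOn E q)
    (hn : q < n) {V : 𝔛.Op} {s : 𝔛.O V} (hs : s ∈ 𝔛.fermionicPow n V) : s = 0 := by
  refine 𝔛.eq_of_locally_eq fun x hx => ?_
  obtain ⟨U, hxU, hfree, hU⟩ := h.2 x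
  obtain ⟨W, hWV, hxW, hW⟩ := hs x hx
  refine ⟨W ⊓ U, inf_le_left.trans hWV, ⟨hxW, hxU⟩, ?_⟩
  rw [map_zero, ← 𝔛.res_res hWV inf_le_left]
  exact hU.eq_zero_of_mem_fermionicIdeal_pow hfree inf_le_right hn
    (𝔛.res_mem_fermionicIdeal_pow _ _ hW)

/-! ### The filtration by the sheaves `𝒥^m` -/

theorem fermionicIdeal_pow_le_fermionicPow (m : ℕ) (U : 𝔛.Op) :
    𝔛.fermionicIdeal U ^ m ≤ 𝔛.fermionicPow m U := fun _ hs _ hx =>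
  ⟨U, le_rfl, hx, 𝔛.res_mem_fermionicIdeal_pow _ _ hs⟩

/-- Membership in `𝒥^m` is local. -/
theorem mem_fermionicPow_of_locally {m : ℕ} {U : 𝔛.Op} {s : 𝔛.O U}
    (h : ∀ x ∈ U, ∃ (V : 𝔛.Op) (h : V ≤ U), x ∈ V ∧ 𝔛.res h s ∈ 𝔛.fermionicPow m V) :
    s ∈ 𝔛.fermionicPow m U := fun x hx => by
  obtain ⟨V, hVU, hxV, hV⟩ := h x hx
  obtain ⟨W, hWV, hxW, hW⟩ := hV x hxV
  exact ⟨W, hWV.trans hVU, hxW, by rwa [𝔛.res_res] at hW⟩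

theorem fermionicPow_succ_le (m : ℕ) (U : 𝔛.Op) :
    𝔛.fermionicPow (m + 1) U ≤ 𝔛.fermionicPow m U := fun _ hs x hx =>
  let ⟨V, h, hxV, hV⟩ := hs x hx
  ⟨V, h, hxV, Ideal.pow_le_pow_right m.le_succ hV⟩

theorem fermionicPow_antitone (U : 𝔛.Op) : Antitone fun m => 𝔛.fermionicPow m U :=
  antitone_nat_of_succ_le fun m => 𝔛.fermionicPow_succ_le m U

theorem mul_mem_fermionicPow {m n : ℕ} {U : 𝔛.Op} {s t : 𝔛.O U} (hs : s ∈ 𝔛.fermionicPow m U)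
    (ht : t ∈ 𝔛.fermionicPow n U) : s * t ∈ 𝔛.fermionicPow (m + n) U := fun x hx => by
  obtain ⟨V, hV, hxV, hs⟩ := hs x hx
  obtain ⟨W, hW, hxW, ht⟩ := ht x hx
  refine ⟨V ⊓ W, inf_le_left.trans hV, ⟨hxV, hxW⟩, ?_⟩
  have hs' := 𝔛.res_mem_fermionicIdeal_pow (inf_le_left : V ⊓ W ≤ V) _ hs
  have ht' := 𝔛.res_mem_fermionicIdeal_pow (inf_le_right : V ⊓ W ≤ W) _ ht
  rw [𝔛.res_res] at hs' ht'
  rw [map_mul]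
  -- For a left ideal I of a noncommutative ring, I * I ^ 0 can exceed I; exponent 0 uses that the
  -- fermionic ideal is two-sided.
  obtain rfl | hn := eq_or_ne n 0
  · exact Ideal.IsTwoSided.mul_mem_of_left _ hs'
  · rw [Submodule.pow_add _ hn]
    exact Ideal.mul_mem_mul hs' ht'

/-! ### Even automorphisms and the filtration -/

variable {𝔛} {U V : 𝔛.Op}

theorem EvenAut.app_mem_fermionicIdeal (α : 𝔛.EvenAut U) (hV : V ≤ U)
    (hodd : 𝔛.fermionicIdeal V = Ideal.span (𝔛.parity V 1 : Set (𝔛.O V))) {s : 𝔛.O V}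
    (hs : s ∈ 𝔛.fermionicIdeal V) : α.app V hV s ∈ 𝔛.fermionicIdeal V := by
  rw [hodd] at hs ⊢
  refine Submodule.span_induction (fun y hy => ?_) ?_ (fun a b _ _ ha hb => ?_)
    (fun a y _ hy => ?_) hs
  · exact Ideal.subset_span ((α.app_mem_parity V hV 1 y).mpr hy)
  · rw [map_zero]; exact zero_mem _
  · rw [map_add]; exact add_mem ha hb
  · rw [smul_eq_mul, map_mul]; exact Ideal.mul_mem_left _ _ hy

namespace IsGeneratedByOdd

theorem exists_res_mem (h𝔛 : 𝔛.IsGeneratedByOdd) {m : ℕ} {s : 𝔛.O V} (hs : s ∈ 𝔛.fermionicPow m V)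
    {x} (hx : x ∈ V) :
    ∃ (W : 𝔛.Op) (h : W ≤ V), x ∈ W ∧ 𝔛.res h s ∈ 𝔛.fermionicIdeal W ^ m ∧
      𝔛.fermionicIdeal W = Ideal.span (𝔛.parity W 1 : Set (𝔛.O W)) := by
  obtain ⟨U', hxU, hU'⟩ := h𝔛 x
  obtain ⟨W, hWV, hxW, hW⟩ := hs x hx
  refine ⟨W ⊓ U', inf_le_left.trans hWV, ⟨hxW, hxU⟩, ?_, hU' _ inf_le_right⟩
  rw [← 𝔛.res_res hWV inf_le_left]
  exact 𝔛.res_mem_fermionicIdeal_pow _ _ hW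

/-- Even automorphisms preserve the sheaves of ideals `𝒥^m`. -/
theorem app_mem_fermionicPow (h𝔛 : 𝔛.IsGeneratedByOdd) (α : 𝔛.EvenAut U) (hV : V ≤ U)
    {m : ℕ} {s : 𝔛.O V}
    (hs : s ∈ 𝔛.fermionicPow m V) : α.app V hV s ∈ 𝔛.fermionicPow m V := fun x hx => by
  obtain ⟨W, hWV, hxW, hW, hodd⟩ := h𝔛.exists_res_mem hs hx
  refine ⟨W, hWV, hxW, ?_⟩
  rw [← α.naturality V W hV hWV]
  exact Ideal.map_mem_pow_of_le_comap (α.app W _)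
    (fun _ => α.app_mem_fermionicIdeal (hWV.trans hV) hodd) hW

/-- If `α - 1` maps `𝒪` to `𝒥^m`, then it maps `𝒥^(n+1)` to `𝒥^(m+n)`. -/
theorem app_sub_mem_fermionicPow (h𝔛 : 𝔛.IsGeneratedByOdd) {m : ℕ} {α : 𝔛.EvenAut U}
    (hα : α ∈ 𝔛.autSubgroup m U)
    (hV : V ≤ U) {n : ℕ} {s : 𝔛.O V} (hs : s ∈ 𝔛.fermionicPow (n + 1) V) :
    α.app V hV s - s ∈ 𝔛.fermionicPow (m + n) V := by
  refine 𝔛.mem_fermionicPow_of_locally fun x hx => ?_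
  obtain ⟨W, hWV, hxW, hW, hodd⟩ := h𝔛.exists_res_mem hs hx
  refine ⟨W, hWV, hxW, ?_⟩
  rw [map_sub, ← α.naturality V W hV hWV]
  -- On W the section lies in a genuine power of the ideal, so induction over products applies.
  generalize 𝔛.res hWV s = t at hW
  clear hs
  induction n generalizing t with
  -- A first factor in J gains nothing, since α(b) - b is only known to lie in J^m; hence m + n
  -- rather than m + n + 1.
  | zero => exact hα W _ t
  | succ n ih =>
    rw [Submodule.pow_succ] at hW
    refine Submodule.mul_induction_on hW (fun a ha b hb => ?_) (fun a b ha hb => ?_)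
    · have hb' : b ∈ 𝔛.fermionicPow 1 W :=
        𝔛.fermionicIdeal_pow_le_fermionicPow 1 W (by rwa [Submodule.pow_one])
      have e : α.app W (hWV.trans hV) (a * b) - a * b =
          (α.app W (hWV.trans hV) a - a) * α.app W (hWV.trans hV) b +
            a * (α.app W (hWV.trans hV) b - b) := by
        rw [map_mul, sub_mul, mul_sub]; abel
      rw [e]
      refine add_mem ?_ ?_
      · rw [← add_assoc]
        exact 𝔛.mul_mem_fermionicPow (ih a ha) (h𝔛.app_mem_fermionicPow α _ hb')
      · rw [add_comm m]
        exact 𝔛.mul_mem_fermionicPow (𝔛.fermionicIdeal_pow_le_fermionicPow _ W ha) (hα W _ b)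
    · rw [map_add, add_sub_add_comm]; exact add_mem ha hb

theorem isNormalInclusion (h𝔛 : 𝔛.IsGeneratedByOdd) (m : ℕ) : 𝔛.IsNormalInclusion m := fun U => by
  refine ⟨fun α hα V hV u => 𝔛.fermionicPow_succ_le m V (hα V hV u), ⟨?_⟩⟩
  rintro ⟨β, _⟩ hβ ⟨α, _⟩ V hV u
  change α.app V hV (β.app V hV ((α.app V hV).symm u)) - u ∈ _
  -- With w = α⁻¹(u), the difference αβα⁻¹(u) - u becomes α(β(w) - w).
  conv => enter [2, 2]; rw [← (α.app V hV).apply_symm_apply u]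
  rw [← map_sub]
  exact h𝔛.app_mem_fermionicPow α hV (hβ V hV _)

/-- For `m ≥ 2`, sections of `𝒢^(m)` commute modulo `𝒢^(m+1)`. -/
theorem inv_mul_mem_autSubgroup (h𝔛 : 𝔛.IsGeneratedByOdd) {m : ℕ} (hm : 2 ≤ m) {α β : 𝔛.EvenAut U}
    (hα : α ∈ 𝔛.autSubgroup m U) (hβ : β ∈ 𝔛.autSubgroup m U) :
    (α * β)⁻¹ * (β * α) ∈ 𝔛.autSubgroup (m + 1) U := fun V hV u => by
  obtain ⟨n, rfl⟩ : ∃ n, m = n + 1 := ⟨m - 1, by omega⟩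
  -- Here n + 1 + n = 2m - 1, and m ≥ 2 gives n ≥ 1.
  have hle := 𝔛.fermionicPow_antitone V (show n + 1 + 1 ≤ n + 1 + n by omega)
  have key : (β * α).app V hV u - (α * β).app V hV u ∈ 𝔛.fermionicPow (n + 1 + 1) V := by
    have e : (β * α).app V hV u - (α * β).app V hV u =
        (β.app V hV (α.app V hV u - u) - (α.app V hV u - u)) -
          (α.app V hV (β.app V hV u - u) - (β.app V hV u - u)) := by
      rw [map_sub, map_sub, EvenAut.mul_app, EvenAut.mul_app, AlgEquiv.mul_apply,
        AlgEquiv.mul_apply]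
      abel
    rw [e]
    exact sub_mem (hle (h𝔛.app_sub_mem_fermionicPow hβ hV (hα V hV u)))
      (hle (h𝔛.app_sub_mem_fermionicPow hα hV (hβ V hV u)))
  -- Applying (αβ)⁻¹, which preserves the filtration, turns βα - αβ into (αβ)⁻¹βα - 1.
  have := h𝔛.app_mem_fermionicPow (α * β)⁻¹ hV key
  rw [map_sub] at this
  have e : (α * β)⁻¹.app V hV ((α * β).app V hV u) = u :=
    ((α * β).app V hV).symm_apply_apply u
  rwa [e] at this

theorem mul_comm_quotientPresheaf (h𝔛 : 𝔛.IsGeneratedByOdd) {m : ℕ} (hm : 2 ≤ m)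
    (hN : 𝔛.IsNormalInclusion m)
    (a b : (𝔛.quotientPresheaf m hN).obj (op U)) : a * b = b * a := by
  have := (hN U).2
  revert a b
  change ∀ a b : 𝔛.autSubgroup m U ⧸ (𝔛.autSubgroup (m + 1) U).subgroupOf (𝔛.autSubgroup m U),
    a * b = b * a
  intro a b
  induction a using QuotientGroup.induction_on with | _ α
  induction b using QuotientGroup.induction_on with | _ β
  exact QuotientGroup.eq.mpr (h𝔛.inv_mul_mem_autSubgroup hm α.2 β.2)

end IsGeneratedByOdd

theorem IsModelledOn.autSubgroup_eq_bot {E : SheafOfModules.{u} (ringSheaf 𝔛.reduced)} {q n : ℕ}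
    (h : 𝔛.IsModelledOn E q) (hn : q < n) : 𝔛.autSubgroup n U = ⊥ := by
  refine (Subgroup.eq_bot_iff_forall _).mpr fun α hα => ?_
  ext V hV s
  exact sub_eq_zero.mp (h.eq_zero_of_mem_fermionicPow hn (hα V hV s))

end Superspace

theorem mainTheorem10 {k : Type v} [CommRing k] (𝔛 : Supermanifold.{v, u} k) :
    (∀ m : ℤ, (𝔛.oddDim : ℤ) < m → ∀ U : 𝔛.Op, 𝔛.autSections m U = {1}) ∧
    (∀ m : ℤ, m < 0 → ∀ U : 𝔛.Op, 𝔛.autSections m U = ∅) ∧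
    ∃ hN : ∀ m : ℕ, 𝔛.IsNormalInclusion m,
      ∀ m : ℕ, 2 ≤ m → ∀ (U : 𝔛.Op) (a b : (𝔛.quotientSheaf m (hN m)).obj.obj (op U)),
        a * b = b * a := by
  obtain ⟨E, hE⟩ := 𝔛.exists_model
  have hodd := hE.isGeneratedByOdd
  refine ⟨fun m hm U => ?_, fun m hm U => ?_, hodd.isNormalInclusion, fun m hm U a b => ?_⟩
  · obtain ⟨n, rfl⟩ := Int.eq_ofNat_of_zero_le (show 0 ≤ m by omega)
    ext α
    constructor
    · rintro ⟨n', hn', hα⟩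
      rw [hE.autSubgroup_eq_bot (by omega)] at hα
      exact hα
    · rintro rfl
      exact ⟨n, rfl, one_mem _⟩
  · refine Set.eq_empty_of_forall_notMem ?_
    rintro α ⟨n, rfl, -⟩
    omega
  · exact TopCat.Presheaf.mul_comm_sheafify _
      (fun _ a b => hodd.mul_comm_quotientPresheaf hm _ a b) U a b
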